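/- Let $\mu$ be a regular cardinal and let $\mathcal{C}$ be a $\mu$-accessible category all of whose morphisms are monomorphisms. Let $\nu$ be the number of morphisms between $\mu$-presentable objects of $\mathcal{C}$, where these objects are taken up to isomorphism, i.e. $\nu$ is the cardinality of the set of morphisms of a skeleton of the full subcategory of $\mu$-presentable objects. Then $\mathcal{C}$ is equivalent (as a category) to a $\mu$-abstract elementary class whose Löwenheim–Skolem–Tarski number is $\max(\mu,\nu)^{<\mu}$. Here the following definitions are used. For cardinals $\kappa$, $\kappa^{<\mu}=\sup_{\gamma<\mu}\kappa^{\gamma}$. A $\mu$-ary language $L$ is a set of function and relation symbols, each of which has an ordinal less than $\mu$ as its arity; $|L|$ is the number of its symbols. An embedding of $L$-structures is an injective map that commutes with the functions and preserves and reflects the relations; $M\subseteq N$ means that the universe $|M|$ is a subset of $|N|$ and the inclusion is an embedding. A $\mu$-abstract class $(\mathcal{K},\le)$ is a class $\mathcal{K}$ of $L$-structures, for a fixed $\mu$-ary language $L$, with a reflexive and transitive relation $\le$ on $\mathcal{K}$ such that $M\le N$ implies $M\subseteq N$, and such that, for every $L$-isomorphism $f:N\to N'$ with $N\in\mathcal{K}$,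 we have $N'\in\mathcal{K}$, and $M\le N$ implies $f(M)\in\mathcal{K}$ and $f(M)\le N'$. It is a $\mu$-abstract elementary class ($\mu$-AEC) if: 1. if $M_0,M_1,M_2\in\mathcal{K}$, $M_0\le M_2$, $M_1\le M_2$ and $M_0\subseteq M_1$, then $M_0\le M_1$; 2. if $I$ is a $\mu$-directed partially ordered set (every subset of cardinality less than $\mu$ has an upper bound) and $(M_i)_{i\in I}$ is a family in $\mathcal{K}$ with $M_i\le M_j$ for $i<j$, then $\bigcup_i M_i\in\mathcal{K}$ and $M_j\le\bigcup_i M_i$ for all $j\in I$; and if moreover $N\in\mathcal{K}$ satisfies $M_i\le N$ for all $i\in I$, then $\bigcup_i M_i\le N$; 3. there is a cardinal $\lambda=\lambda^{<\mu}\ge|L|+\mu$ such that for all $M\in\mathcal{K}$ and $A\subseteq|M|$ there is $N\le M$ whose universe contains $A$ and has cardinality at most $|A|^{<\mu}+\lambda$. The least $\lambda$ as in 3 is the Löwenheim–Skolem–Tarski number of $\mathcal{K}$. A $\mu$-AEC is regarded as the category whose objects are the structures in $\mathcal{K}$ and whose morphisms $M\to N$ are the embeddings $f:M\to N$ with $f(M)\in\mathcal{K}$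 and $f(M)\le N$. -/

import Mathlib

open CategoryTheory

universe w v u

namespace MuAEC

/-- A `μ`-ary language: a set of function symbols and a set of relation symbols, each symbol having
as arity an ordinal below (the initial ordinal of) `μ`. -/
structure Language (μ : Cardinal.{w}) where
  Func : Type w
  Rel : Type w
  funcArity : Func → Ordinal.{w}
  relArity : Rel → Ordinal.{w}
  funcArity_lt : ∀ F, funcArity F < μ.ord
  relArity_lt : ∀ R, relArity R < μ.ord

variable {μ : Cardinal.{w}}

/-- The number of symbols of the language. -/
def Language.card (L : Language μ) : Cardinal.{w} := Cardinal.mk (L.Func ⊕ L.Rel)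

/-- Sequences of length the ordinal `α` with entries in `X`. -/
abbrev Tuple (α : Ordinal.{w}) (X : Type w) : Type w := α.ToType → X

/-- An `L`-structure whose universe is a subset of the type `U`. As types (unlike sets) cannot be
literally compared by inclusion, universes of structures are subsets of ambient types `U`, which are
arbitrary; two structures with the same ambient type can then be compared literally. -/
structure Str (L : Language μ) (U : Type w) where
  carrier : Set U
  fn : ∀ F : L.Func, Tuple (L.funcArity F) carrier → carrier
  rel : ∀ R : L.Rel, Set (Tuple (L.relArity R) carrier)

variable {L : Language μ} {U V W : Type w}

/-- Substructure embeddings: injective maps which commute with the functions, and which preserve and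
reflect the relations. -/
@[ext]
structure Emb (M : Str L U) (N : Str L V) where
  toFun : M.carrier → N.carrier
  inj : Function.Injective toFun
  map_fn : ∀ F x, toFun (M.fn F x) = N.fn F (toFun ∘ x)
  map_rel : ∀ R x, x ∈ M.rel R ↔ toFun ∘ x ∈ N.rel R

namespace Emb

/-- The identity embedding. -/
def id (M : Str L U) : Emb M M where
  toFun := fun x => x
  inj := fun _ _ h => h
  map_fn _ _ := rfl
  map_rel _ _ := Iff.rfl

/-- Composition of embeddings (first `f`, then `g`). -/
def comp {M : Str L U} {N : Str L V} {P : Str L W} (f : Emb M N) (g : Emb N P) : Emb M P where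
  toFun := g.toFun ∘ f.toFun
  inj := g.inj.comp f.inj
  map_fn F x := by
    simp only [Function.comp_apply, f.map_fn, g.map_fn]
    rfl
  map_rel R x := (f.map_rel R x).trans (g.map_rel R _)

/-- `L`-isomorphisms are the surjective embeddings. -/
def IsIso {M : Str L U} {N : Str L V} (f : Emb M N) : Prop := Function.Surjective f.toFun

/-- The set of elements of (the ambient type of) `N` hit by the embedding `f`. -/
def rangeSet {M : Str L U} {N : Str L V} (f : Emb M N) : Set V :=
  Set.range fun x => (f.toFun x : V)

/-- The bijection of `M` with its image. -/
noncomputable def equivRange {M : Str L U} {N : Str L V} (f : Emb M N) :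
    M.carrier ≃ f.rangeSet :=
  Equiv.ofInjective (fun x => (f.toFun x : V)) (Subtype.val_injective.comp f.inj)

/-- The image `f(M)` of an embedding `f : M → N`: its universe is the image of the universe of `M`,
and its structure is transported along `f`. -/
noncomputable def image {M : Str L U} {N : Str L V} (f : Emb M N) : Str L V where
  carrier := f.rangeSet
  fn F x := f.equivRange (M.fn F (f.equivRange.symm ∘ x))
  rel R := {x | f.equivRange.symm ∘ x ∈ M.rel R}

/-- The isomorphism of `M` with `f(M)`. -/
noncomputable def toImage {M : Str L U} {N : Str L V} (f : Emb M N) : Emb M f.image where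
  toFun := f.equivRange
  inj := f.equivRange.injective
  map_fn F x := by
    change _ = f.equivRange (M.fn F (f.equivRange.symm ∘ (f.equivRange ∘ x)))
    rw [← Function.comp_assoc, f.equivRange.symm_comp_self, Function.id_comp]
  map_rel R x := by
    change _ ↔ f.equivRange.symm ∘ (f.equivRange ∘ x) ∈ M.rel R
    rw [← Function.comp_assoc, f.equivRange.symm_comp_self, Function.id_comp]

end Emb

/-- `M ⊆ N`: the universe of `M` is contained in that of `N`, and the inclusion is a substructure
embedding. -/
structure IsSubmodel (M N : Str L U) : Prop where
  subset : M.carrier ⊆ N.carrier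
  map_fn : ∀ F x, Set.inclusion subset (M.fn F x) = N.fn F (Set.inclusion subset ∘ x)
  map_rel : ∀ R x, x ∈ M.rel R ↔ Set.inclusion subset ∘ x ∈ N.rel R

/-- The inclusion of a submodel. -/
def IsSubmodel.incl {M N : Str L U} (h : IsSubmodel M N) : Emb M N where
  toFun := Set.inclusion h.subset
  inj := Set.inclusion_injective h.subset
  map_fn := h.map_fn
  map_rel := h.map_rel

/-- A `μ`-abstract class `(K, ≤)` of `L`-structures: a class `K` of `L`-structures together with a
relation `≤` on `K` which is reflexive and transitive, refines the submodel relation, and respects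
`L`-isomorphisms. -/
structure AbstractClass (L : Language μ) where
  mem : ∀ {U : Type w}, Str L U → Prop
  le : ∀ {U : Type w}, Str L U → Str L U → Prop
  mem_left : ∀ {U : Type w} {M N : Str L U}, le M N → mem M
  mem_right : ∀ {U : Type w} {M N : Str L U}, le M N → mem N
  refl : ∀ {U : Type w} {M : Str L U}, mem M → le M M
  trans : ∀ {U : Type w} {M N P : Str L U}, le M N → le N P → le M P
  isSubmodel : ∀ {U : Type w} {M N : Str L U}, le M N → IsSubmodel M N
  mem_iso : ∀ {U V : Type w} {N : Str L U} {N' : Str L V} (f : Emb N N'),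
    f.IsIso → mem N → mem N'
  le_iso : ∀ {U V : Type w} {M N : Str L U} {N' : Str L V} (f : Emb N N'),
    f.IsIso → ∀ h : le M N, le ((isSubmodel h).incl.comp f).image N'

/-- A partially ordered set is `μ`-directed if each of its subsets of cardinality less than `μ` has
an upper bound. -/
def IsDirectedSet (μ : Cardinal.{w}) (I : Type w) [PartialOrder I] : Prop :=
  ∀ J : Set I, Cardinal.mk J < μ → ∃ r, ∀ s ∈ J, s ≤ r

/-- `P` is the union of the structures `M i`: its universe is the union of their universes, and each
`M i` is a submodel of `P`. (When the `M i` form a `μ`-directed system of submodels, `μ` regular,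
there is exactly one such structure, the arities being less than `μ`.) -/
structure IsUnion {I : Type w} (M : I → Str L U) (P : Str L U) : Prop where
  carrier_eq : P.carrier = ⋃ i, (M i).carrier
  isSubmodel : ∀ i, IsSubmodel (M i) P

namespace AbstractClass

variable (K : AbstractClass L)

/-- Coherence. -/
def Coherence : Prop :=
  ∀ {U : Type w} {M₀ M₁ M₂ : Str L U}, K.mem M₀ → K.mem M₁ → K.mem M₂ →
    K.le M₀ M₂ → K.le M₁ M₂ → IsSubmodel M₀ M₁ → K.le M₀ M₁

/-- The Tarski–Vaught axioms, for `μ`-directed systems: the union exists in `K`, is an upper bound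
of the system, and is below each upper bound. -/
def TarskiVaught : Prop :=
  ∀ {U : Type w} {I : Type w} [PartialOrder I], IsDirectedSet μ I →
    ∀ M : I → Str L U, (∀ i, K.mem (M i)) → (∀ i j, i < j → K.le (M i) (M j)) →
      ∃ P : Str L U, IsUnion M P ∧ K.mem P ∧ (∀ j, K.le (M j) P) ∧
        ∀ N : Str L U, K.mem N → (∀ i, K.le (M i) N) → K.le P N

/-- The cardinal `l` satisfies the Löwenheim–Skolem–Tarski property for `K`:
`l = l^{<μ} ≥ |L| + μ`, and for all `M ∈ K` and `A ⊆ |M|` there is `N ≤ M` with `A ⊆ |N|` and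
`‖N‖ ≤ |A|^{<μ} + l`. -/
def LSTProperty (l : Cardinal.{w}) : Prop :=
  l ^< μ = l ∧ L.card + μ ≤ l ∧
    ∀ {U : Type w} (M : Str L U), K.mem M → ∀ A : Set U, A ⊆ M.carrier →
      ∃ N : Str L U, K.le N M ∧ A ⊆ N.carrier ∧
        Cardinal.mk N.carrier ≤ Cardinal.mk A ^< μ + l

/-- `K` is a `μ`-abstract elementary class. -/
structure IsAEC : Prop where
  regular : μ.IsRegular
  coherence : K.Coherence
  tarskiVaught : K.TarskiVaught
  lst : ∃ l, K.LSTProperty l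

/-- `l` is the Löwenheim–Skolem–Tarski number `LS(K)`, the least cardinal with the
Löwenheim–Skolem–Tarski property. -/
def IsLSTNumber (l : Cardinal.{w}) : Prop := IsLeast {l | K.LSTProperty l} l

end AbstractClass

theorem IsSubmodel.eq_of_carrier_eq {M M' N : Str L U} (h : IsSubmodel M N)
    (h' : IsSubmodel M' N) (e : M.carrier = M'.carrier) : M = M' := by
  obtain ⟨c, fn, rel⟩ := M
  obtain ⟨c', fn', rel'⟩ := M'
  obtain rfl : c = c' := e
  congr
  · funext F x
    exact Set.inclusion_injective h.subset ((h.map_fn F x).trans (h'.map_fn F x).symm)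
  · funext R
    ext x
    exact (h.map_rel R x).trans (h'.map_rel R x).symm

theorem Emb.image_isSubmodel {M : Str L U} {N : Str L V} (f : Emb M N) :
    IsSubmodel f.image N := by
  have hs : f.image.carrier ⊆ N.carrier := by
    rintro _ ⟨x, rfl⟩
    exact (f.toFun x).2
  have key : ∀ y : f.rangeSet, Set.inclusion hs y = f.toFun (f.equivRange.symm y) := by
    intro y
    obtain ⟨x, rfl⟩ := f.equivRange.surjective y
    rw [Equiv.symm_apply_apply]
    rfl
  refine ⟨hs, fun F x => ?_, fun R x => ?_⟩
  · refine (key _).trans ?_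
    change f.toFun (f.equivRange.symm (f.equivRange (M.fn F (f.equivRange.symm ∘ x)))) = _
    rw [Equiv.symm_apply_apply, f.map_fn]
    congr 1
    funext i
    exact (key (x i)).symm
  · refine (f.map_rel R (f.equivRange.symm ∘ x)).trans (Eq.to_iff ?_)
    congr 1
    funext i
    exact (key (x i)).symm

namespace AbstractClass

variable (K : AbstractClass L)

/-- An embedding `f : M → N` is a `K`-embedding if `f(M) ≤ N`. -/
def IsKEmb {M : Str L U} {N : Str L V} (f : Emb M N) : Prop := K.le f.image N

theorem isKEmb_id {M : Str L U} (hM : K.mem M) : K.IsKEmb (Emb.id M) := by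
  have h := K.refl hM
  have e : (Emb.id M).image = M :=
    (Emb.id M).image_isSubmodel.eq_of_carrier_eq (K.isSubmodel h) (by
      ext x
      constructor
      · rintro ⟨y, rfl⟩
        exact y.2
      · intro hx
        exact ⟨⟨x, hx⟩, rfl⟩)
  unfold IsKEmb
  rwa [e]

theorem isKEmb_comp {M : Str L U} {N : Str L V} {P : Str L W} {f : Emb M N} {g : Emb N P}
    (hf : K.IsKEmb f) (hg : K.IsKEmb g) : K.IsKEmb (f.comp g) := by
  have h := K.le_iso g.toImage g.equivRange.surjective hf
  have h' := K.trans h hg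
  have e : (f.comp g).image = ((K.isSubmodel hf).incl.comp g.toImage).image :=
    (f.comp g).image_isSubmodel.eq_of_carrier_eq (K.isSubmodel h') (by
      ext x
      constructor
      · rintro ⟨y, rfl⟩
        exact ⟨f.equivRange y, rfl⟩
      · rintro ⟨y, rfl⟩
        obtain ⟨y, rfl⟩ := f.equivRange.surjective y
        exact ⟨y, rfl⟩)
  unfold IsKEmb
  rwa [e]

/-- The members of `K`, as objects of a category. -/
structure Model where
  {ambient : Type w}
  str : Str L ambient
  mem : K.mem str

/-- The category of the abstract class `K`: its objects are the members of `K`, its morphisms are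
the `K`-embeddings, composed as maps. -/
instance : Category.{w} K.Model where
  Hom M N := {f : Emb M.str N.str // K.IsKEmb f}
  id M := ⟨Emb.id M.str, K.isKEmb_id M.mem⟩
  comp f g := ⟨f.1.comp g.1, K.isKEmb_comp f.2 g.2⟩

end AbstractClass

/-- The number of morphisms between `μ`-presentable objects of `C`, these being taken up to
isomorphism: the number of morphisms of a skeleton of the full subcategory of `μ`-presentable
objects (replaced by an equivalent small category, so that the number is a cardinal of the universe
in which `C` is accessible). -/
noncomputable def presentableMorphisms (C : Type u) [Category.{v} C] (μ : Cardinal.{w})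
    [Fact μ.IsRegular] [IsCardinalAccessibleCategory C μ] : Cardinal.{w} :=
  Cardinal.mk (Σ X Y : Skeleton (SmallModel.{w} (isCardinalPresentable C μ).FullSubcategory), X ⟶ Y)

end MuAEC

/-! Let `S` be a small skeleton of the `μ`-presentable objects, with inclusion `G`. Interpret an
object `X` as the set `Elt G X` of all morphisms `G.obj s ⟶ X`, with one binary relation for each
morphism of `S`, recording restriction along it. The language then has exactly `ν` symbols.

Every object is a `μ`-directed colimit of `μ`-presentable ones, so morphisms `X ⟶ Y` are the same as
restriction-preserving maps of elements (`hom_ext_of_elt`, `exists_hom_of_restricts`). Since all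
morphisms are monic, they act injectively and reflect the relations, so they are precisely the
embeddings. Hence `C` is equivalent to the class of all structures isomorphic to some `Elt G X`,
with `≤` being plain `⊆` between members; coherence is then free.

A morphism from a `μ`-presentable object into a `μ`-directed colimit factors through a stage, and
the legs are monic, so unions of structures are colimits in `C` (`exists_union_equiv`). For
Löwenheim–Skolem–Tarski, write `X` as a `μ`-directed colimit, enlarge the indices needed for `A` to
a small `μ`-directed subset, and take the colimit over it (`exists_le_of_mk_le`). The bound is least
because any admissible `l` satisfies `l = l ^< μ` and `l ≥ ν + μ`. -/

namespace Cardinal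

open Set

/-! ### Cardinal arithmetic of `κ ^< μ` and small directed subsets. -/

theorem powerlt_mono_right {a b μ : Cardinal.{w}} (h : a ≤ b) : a ^< μ ≤ b ^< μ :=
  powerlt_le.2 fun _ hx => (power_le_power_right h).trans (le_powerlt b hx)

theorem self_le_powerlt {a μ : Cardinal.{w}} (h : 1 < μ) : a ≤ a ^< μ := by
  simpa using le_powerlt a h

/-- Otherwise `a ^< μ` would itself be an admissible exponent, contradicting Cantor's theorem. -/
theorem exponent_le_powerlt {a μ : Cardinal.{w}} (ha : 2 ≤ a) : μ ≤ a ^< μ := by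
  by_contra! h
  exact absurd ((cantor' _ (one_lt_two.trans_le ha)).trans_le (le_powerlt a h)) (lt_irrefl _)

theorem mk_Iio_toType_lt {μ : Cardinal.{w}} (i : μ.ord.ToType) : #(Iio i) < μ := by
  simpa using mk_Iio_lt i (by simp)

theorem exists_mk_Iio_eq {γ μ : Cardinal.{w}} (h : γ < μ) :
    ∃ i : μ.ord.ToType, #(Iio i) = γ := by
  have h' : γ.ord < Ordinal.type (α := μ.ord.ToType) (· < ·) := by
    rw [Ordinal.type_toType]
    exact ord_lt_ord.2 h
  refine ⟨Ordinal.enum (α := μ.ord.ToType) (· < ·) ⟨γ.ord, h'⟩, ?_⟩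
  have := Ordinal.typein_enum (α := μ.ord.ToType) (· < ·) h'
  have h2 := congrArg Ordinal.card this
  rwa [card_ord] at h2

/-- Short sequences: those whose length is smaller than (the initial ordinal of) `μ`. -/
abbrev ShortSeq (μ : Cardinal.{w}) (X : Type w) : Type w :=
  Σ i : μ.ord.ToType, (Iio i → X)

theorem mk_shortSeq_le {μ : Cardinal.{w}} (X : Type w) : #(ShortSeq μ X) ≤ μ * #X ^< μ := by
  rw [mk_sigma]
  refine (sum_le_sum _ (fun _ => #X ^< μ) fun i => ?_).trans (by simp)
  rw [← power_def]
  exact le_powerlt _ (mk_Iio_toType_lt i)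

theorem mk_shortSeq_below_le {μ : Cardinal.{w}} {X : Type w} (hX : 2 ≤ #X) (k : μ.ord.ToType) :
    #(Σ i : Iio k, (Iio (i : μ.ord.ToType) → X)) ≤ #X ^ (#(Iio k) + #(Iio k)) := by
  have h0 : #X ≠ 0 := (two_pos.trans_le hX).ne'
  rw [mk_sigma]
  refine (sum_le_sum _ (fun _ => #X ^ #(Iio k)) fun i => ?_).trans ?_
  · rw [← power_def]
    exact power_le_power_left h0 (mk_le_mk_of_subset (Iio_subset_Iio i.2.le))
  · rw [sum_const', power_add]
    gcongr
    exact (cantor' _ (one_lt_two.trans_le hX)).le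

/-- Since `μ` is regular, less than `μ` short sequences are of uniformly bounded length. -/
theorem exists_short_bound {μ : Cardinal.{w}} [hμ : Fact μ.IsRegular] {D : Type w} (hD : #D < μ)
    (f : D → μ.ord.ToType) : ∃ k, ∀ d, f d < k := by
  have : NoMaxOrder μ.ord.ToType := noMaxOrder hμ.out.aleph0_le
  rw [← hasCardinalLT_iff_cardinal_mk_lt] at hD
  obtain ⟨k, hk⟩ := exists_gt (IsCardinalFiltered.max f hD)
  exact ⟨k, fun d => (leOfHom (IsCardinalFiltered.toMax f hD d)).trans_lt hk⟩

/-- By regularity, fewer than `μ` short sequences have lengths below a common `k`. So the families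
are covered by `μ` many sets, each of size at most `#X` to an exponent below `μ`, and `μ ≤ #X ^< μ`
absorbs the number of choices of `k`. -/
theorem powerlt_powerlt {a μ : Cardinal.{w}} [hμ : Fact μ.IsRegular] (ha : 2 ≤ a) :
    (a ^< μ) ^< μ = a ^< μ := by
  have hμ0 := hμ.out.aleph0_le
  refine le_antisymm (powerlt_le.2 fun δ hδ => ?_)
    (self_le_powerlt (one_lt_aleph0.trans_le hμ0))
  induction a using Cardinal.inductionOn with | _ X
  induction δ using Cardinal.inductionOn with | _ D
  have hμs : μ ≤ #X ^< μ := exponent_le_powerlt ha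
  have hs : ℵ₀ ≤ #X ^< μ := hμ0.trans hμs
  have h1 : #X ^< μ ≤ #(ShortSeq μ X) := by
    refine powerlt_le.2 fun γ hγ => ?_
    obtain ⟨i, hi⟩ := exists_mk_Iio_eq hγ
    rw [mk_sigma, ← hi, power_def]
    exact le_sum (fun i : μ.ord.ToType => #(Iio i → X)) i
  refine (power_le_power_right h1).trans ?_
  rw [power_def]
  let F : (Σ k : μ.ord.ToType, D → Σ i : Iio k, (Iio (i : μ.ord.ToType) → X)) →
      (D → ShortSeq μ X) := fun p d => ⟨(p.2 d).1, (p.2 d).2⟩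
  have hF : Function.Surjective F := by
    intro f
    obtain ⟨k, hk⟩ := exists_short_bound hδ fun d => (f d).1
    exact ⟨⟨k, fun d => ⟨⟨(f d).1, hk d⟩, (f d).2⟩⟩, rfl⟩
  refine (mk_le_of_surjective hF).trans ?_
  rw [mk_sigma]
  refine (sum_le_sum _ (fun _ => #X ^< μ) fun k => ?_).trans ?_
  · rw [← power_def]
    refine (power_le_power_right (mk_shortSeq_below_le ha k)).trans ?_
    rw [← power_mul]
    have hk := mk_Iio_toType_lt k
    exact le_powerlt _ (mul_lt_of_lt hμ0 (add_lt_of_lt hμ0 hk hk) hδ)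
  · rw [sum_const', mk_ord_toType]
    exact (mul_le_mul_left hμs _).trans (mul_eq_self hs).le

/-- A set of cardinality `κ = κ^{<μ}` has at most `κ` subsets of cardinality less than `μ`. -/
theorem mk_setCardinalLT_le {κ μ : Cardinal.{w}} (hμ : μ ≤ κ) (h0 : ℵ₀ ≤ κ) (hκ : κ ^< μ = κ)
    {X : Type w} (hX : #X ≤ κ) : #(CardinalDirectedPoset.SetCardinalLT μ X) ≤ κ := by
  let F : ShortSeq μ X → CardinalDirectedPoset.SetCardinalLT μ X := fun p => ⟨range p.2, by
    rw [hasCardinalLT_iff_cardinal_mk_lt]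
    exact mk_range_le.trans_lt (mk_Iio_toType_lt p.1)⟩
  have hF : Function.Surjective F := by
    rintro ⟨s, hs⟩
    rw [hasCardinalLT_iff_cardinal_mk_lt] at hs
    obtain ⟨i, hi⟩ := exists_mk_Iio_eq hs
    obtain ⟨e⟩ := Cardinal.eq.1 hi
    refine ⟨⟨i, fun j => e j⟩, Subtype.ext ?_⟩
    change range (Subtype.val ∘ e) = s
    rw [e.surjective.range_comp, Subtype.range_val]
  refine (mk_le_of_surjective hF).trans ((mk_shortSeq_le X).trans ?_)
  refine (mul_le_mul' hμ ((powerlt_mono_right hX).trans hκ.le)).trans (mul_eq_self h0).le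

/-- Because `κ ^< μ = κ`, a set of size at most `κ` has at most `κ` subsets of size below `μ`. This
makes `μ` sharply smaller than `κ⁺`, which allows closing `A` under upper bounds of such subsets. -/
theorem exists_cardinalFiltered_set {κ μ : Cardinal.{w}} [hμ : Fact μ.IsRegular] (hμκ : μ ≤ κ)
    (hκ : κ ^< μ = κ) {X : Type w} [PartialOrder X] [IsCardinalFiltered X μ] (A : Set X)
    (hA : #A ≤ κ) : ∃ B : Set X, A ⊆ B ∧ IsCardinalFiltered B μ ∧ #B ≤ κ := by
  have h0 : ℵ₀ ≤ κ := hμ.out.aleph0_le.trans hμκ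
  have : Fact (Order.succ κ).IsRegular := ⟨isRegular_succ h0⟩
  obtain ⟨B, hAB, hB, hBκ⟩ := SharplyLT.exists_isCardinalFiltered_set_of_exists_cofinal
    (κ₁ := μ) (κ₂ := Order.succ κ) (Order.lt_succ_of_le hμκ) (fun X hX => ⟨Set.univ, by
      rw [hasCardinalLT_iff_cardinal_mk_lt, Order.lt_succ_iff] at hX ⊢
      rw [mk_univ]
      exact mk_setCardinalLT_le hμκ h0 hκ hX, fun x => ⟨x, Set.mem_univ _, le_rfl⟩⟩) A
    (by rwa [hasCardinalLT_iff_cardinal_mk_lt, Order.lt_succ_iff])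
  rw [hasCardinalLT_iff_cardinal_mk_lt, Order.lt_succ_iff] at hBκ
  exact ⟨B, hAB, hB, hBκ⟩

theorem powerlt_add_eq {a l μ : Cardinal.{w}} [hμ : Fact μ.IsRegular] (hl : μ ≤ l)
    (h : l ^< μ = l) : (a ^< μ + l) ^< μ = a ^< μ + l := by
  have h0 : ℵ₀ ≤ l := hμ.out.aleph0_le.trans hl
  rw [add_eq_max' h0]
  rcases le_total (a ^< μ) l with h1 | h1
  · rw [max_eq_right h1, h]
  · rw [max_eq_left h1]
    refine powerlt_powerlt ?_
    -- If `a ≤ 1` then `a ^< μ ≤ 1`, against `ℵ₀ ≤ l ≤ a ^< μ`.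
    by_contra! h2
    have h3 : a ≤ 1 := by
      obtain ⟨n, rfl⟩ := lt_aleph0.1 (h2.trans (natCast_lt_aleph0 (n := 2)))
      have : n < 2 := by exact_mod_cast h2
      exact_mod_cast Nat.lt_succ_iff.1 this
    have h4 : a ^< μ ≤ 1 := powerlt_le.2 fun x _ => (power_le_power_right h3).trans (by simp)
    exact absurd (h0.trans (h1.trans h4)) (not_le.2 one_lt_aleph0)

end Cardinal

namespace MuAEC

open Limits

/-! ### Binary tuples. -/

section Tuples

/-- The positions of a pair. -/
noncomputable def pairEquiv : (2 : Ordinal.{w}).ToType ≃ ULift.{w} Bool :=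
  (Cardinal.eq.1 (by simp)).some

/-- A pair, as a sequence of length two. -/
noncomputable def pair {X : Type w} (a b : X) : Tuple 2 X :=
  fun i => bif (pairEquiv i).down then a else b

theorem comp_pair {X Y : Type w} (f : X → Y) (a b : X) : f ∘ pair a b = pair (f a) (f b) := by
  funext i
  simp only [pair, Function.comp_apply]
  cases (pairEquiv i).down <;> rfl

theorem exists_eq_pair {X : Type w} (x : Tuple 2 X) : ∃ a b, x = pair a b := by
  refine ⟨x (pairEquiv.symm ⟨true⟩), x (pairEquiv.symm ⟨false⟩), funext fun i => ?_⟩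
  obtain ⟨j, rfl⟩ := pairEquiv.symm.surjective i
  rcases j with ⟨_ | _⟩ <;> simp [pair]

theorem pair_inj {X : Type w} {a b a' b' : X} (h : pair a b = pair a' b') : a = a' ∧ b = b' := by
  refine ⟨?_, ?_⟩
  · simpa [pair] using congrFun h (pairEquiv.symm ⟨true⟩)
  · simpa [pair] using congrFun h (pairEquiv.symm ⟨false⟩)

end Tuples

/-! ### Generalized elements and density of the `μ`-presentable objects. -/

section Elements

variable {C : Type u} [Category.{v} C] {S : Type w} [SmallCategory S] (G : S ⥤ C)

/-- The generalized elements of `X`: the morphisms to `X` from the objects `G.obj s`. -/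
abbrev Elt (X : C) := Σ s, (G.obj s ⟶ X)

/-- The morphisms of the category `S`. -/
abbrev Mor (S : Type w) [SmallCategory S] : Type w := Σ s t : S, (s ⟶ t)

variable {G}

/-- `Restricts h p q` says that `q` is the restriction of the generalized element `p`
along `h`. -/
def Restricts {X : C} (h : Mor S) (p q : Elt G X) : Prop :=
  ∃ g : G.obj h.2.1 ⟶ X, p = ⟨h.2.1, g⟩ ∧ q = ⟨h.1, G.map h.2.2 ≫ g⟩

/-- The action of a morphism on generalized elements. -/
def Elt.map {X Y : C} (f : X ⟶ Y) (p : Elt G X) : Elt G Y := ⟨p.1, p.2 ≫ f⟩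

theorem Elt.map_comp {X Y Z : C} (f : X ⟶ Y) (g : Y ⟶ Z) (p : Elt G X) :
    Elt.map (f ≫ g) p = Elt.map g (Elt.map f p) := by
  simp [Elt.map]

theorem Elt.map_id {X : C} (p : Elt G X) : Elt.map (𝟙 X) p = p := by
  simp [Elt.map]

theorem Elt.map_injective {X Y : C} (f : X ⟶ Y) [Mono f] :
    Function.Injective (Elt.map (G := G) f) := by
  rintro ⟨s, p⟩ ⟨t, q⟩ h
  obtain rfl : s = t := congrArg Sigma.fst h
  have h' : p ≫ f = q ≫ f := eq_of_heq (Sigma.mk.inj h).2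
  rw [(cancel_mono f).1 h']

theorem restricts_map_iff {X Y : C} (f : X ⟶ Y) [Mono f] {h : Mor S} {p q : Elt G X} :
    Restricts h (Elt.map f p) (Elt.map f q) ↔ Restricts h p q := by
  constructor
  · rintro ⟨g, hp, hq⟩
    obtain ⟨s, p⟩ := p
    obtain rfl : s = h.2.1 := congrArg Sigma.fst hp
    obtain rfl : p ≫ f = g := eq_of_heq (Sigma.mk.inj hp).2
    refine ⟨p, rfl, Elt.map_injective f ?_⟩
    rw [hq]
    simp [Elt.map]
  · rintro ⟨g, rfl, rfl⟩
    exact ⟨g ≫ f, rfl, by simp [Elt.map]⟩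

variable (G) in
/-- `G` identifies the small category `S` with the full subcategory of `μ`-presentable objects,
up to equivalence. -/
structure IsPresentableModel (μ : Cardinal.{w}) [Fact μ.IsRegular] : Prop where
  full : G.Full
  faithful : G.Faithful
  presentable : ∀ s, IsCardinalPresentable (G.obj s) μ
  exists_iso : ∀ X, IsCardinalPresentable X μ → ∃ s, Nonempty (G.obj s ≅ X)

/-- A presentation of `X` as a colimit of a `μ`-directed diagram of `μ`-presentable objects. -/
theorem exists_directed_presentation (C : Type u) [Category.{v} C] (μ : Cardinal.{w})
    [Fact μ.IsRegular] [IsCardinalAccessibleCategory C μ] (X : C) :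
    ∃ (J : Type w) (_ : PartialOrder J) (_ : IsCardinalFiltered J μ),
      Nonempty ((isCardinalPresentable C μ).ColimitOfShape J X) := by
  obtain ⟨J, _, _, ⟨p⟩⟩ :=
    (isCardinalFilteredGenerator_isCardinalPresentable C μ).exists_colimitsOfShape X
  obtain ⟨J', _, hJ', F, _⟩ := IsCardinalFiltered.exists_cardinal_directed J μ
  exact ⟨J', inferInstance, hJ', ⟨p.reindex F⟩⟩

variable {μ : Cardinal.{w}} [Fact μ.IsRegular] [IsCardinalAccessibleCategory C μ]
  (hG : IsPresentableModel G μ)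

include hG

/-- The legs of a presentation of `X` are jointly epic and are, up to isomorphism, generalized
elements. -/
theorem hom_ext_of_elt {X Y : C} {f g : X ⟶ Y}
    (h : ∀ p : Elt G X, Elt.map f p = Elt.map g p) : f = g := by
  obtain ⟨J, _, _, ⟨p⟩⟩ := exists_directed_presentation C μ X
  refine p.isColimit.hom_ext fun j => ?_
  obtain ⟨s, ⟨e⟩⟩ := hG.exists_iso _ (p.prop_diag_obj j)
  have h' : (e.hom ≫ p.ι.app j) ≫ f = (e.hom ≫ p.ι.app j) ≫ g :=
    eq_of_heq (Sigma.mk.inj (h ⟨s, e.hom ≫ p.ι.app j⟩)).2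
  simpa using h'

/-- Maps of generalized elements which preserve restrictions come from morphisms. -/
theorem exists_hom_of_restricts {X Y : C} (φ : Elt G X → Elt G Y)
    (hφ : ∀ h p q, Restricts h p q → Restricts h (φ p) (φ q)) :
    ∃ f : X ⟶ Y, ∀ p, φ p = Elt.map f p := by
  -- Preserving the relation of `𝟙 s` forces `φ` to preserve the domain `s` of an element.
  have h1 (s : S) (g : G.obj s ⟶ X) : ∃ g' : G.obj s ⟶ Y, φ ⟨s, g⟩ = ⟨s, g'⟩ := by
    obtain ⟨g', h, -⟩ := hφ ⟨s, s, 𝟙 s⟩ ⟨s, g⟩ ⟨s, g⟩ ⟨g, rfl, by simp⟩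
    exact ⟨g', h⟩
  choose ψ hψ using h1
  have h2 {s t : S} (k : s ⟶ t) (g : G.obj t ⟶ X) : ψ s (G.map k ≫ g) = G.map k ≫ ψ t g := by
    obtain ⟨g', h, h'⟩ := hφ ⟨s, t, k⟩ ⟨t, g⟩ ⟨s, G.map k ≫ g⟩ ⟨g, rfl, rfl⟩
    rw [hψ] at h h'
    obtain rfl : ψ t g = g' := eq_of_heq (Sigma.mk.inj h).2
    exact eq_of_heq (Sigma.mk.inj h').2
  have := hG.full
  -- By fullness of `G`, naturality holds along every morphism of `C` between the objects of `G`.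
  have h3 {s t : S} (k : G.obj s ⟶ G.obj t) (g : G.obj t ⟶ X) : ψ s (k ≫ g) = k ≫ ψ t g := by
    obtain ⟨k, rfl⟩ := G.map_surjective k
    exact h2 k g
  obtain ⟨J, _, _, ⟨p⟩⟩ := exists_directed_presentation C μ X
  choose s e using fun j => hG.exists_iso _ (p.prop_diag_obj j)
  replace e := fun j => (e j).some
  -- The values of `φ` on the legs of the presentation, moved along the isomorphisms with objects of
  -- `G`, form a cocone on `Y`.
  let c : Cocone p.diag :=
    { pt := Y
      ι :=
        { app := fun j => (e j).inv ≫ ψ (s j) ((e j).hom ≫ p.ι.app j)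
          naturality := fun i j k => by
            have := h3 ((e i).hom ≫ p.diag.map k ≫ (e j).inv) ((e j).hom ≫ p.ι.app j)
            simp only [Category.assoc, Iso.inv_hom_id_assoc] at this
            have hw := p.ι.naturality k
            simp only [Functor.const_obj_map, Functor.const_obj_obj, Category.comp_id] at hw ⊢
            rw [hw] at this
            simp [this] } }
  refine ⟨p.isColimit.desc c, ?_⟩
  rintro ⟨t, g⟩
  have := hG.presentable t
  -- An arbitrary element factors through a leg, where the induced morphism agrees with `φ` by
  -- construction.
  obtain ⟨j, g', rfl⟩ := IsCardinalPresentable.exists_hom_of_isColimit μ p.isColimit g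
  rw [hψ, Elt.map]
  congr 1
  have h4 := p.isColimit.fac c j
  have h5 := h3 (g' ≫ (e j).inv) ((e j).hom ≫ p.ι.app j)
  simp only [Category.assoc, Iso.inv_hom_id_assoc] at h5
  refine h5.trans ?_
  rw [Category.assoc]
  erw [h4]

end Elements

/-! ### Structures of generalized elements and the abstract class they form. -/

section Structures

variable {C : Type u} [Category.{v} C] {S : Type w} [SmallCategory S] (G : S ⥤ C)
  {μ : Cardinal.{w}} [hμ : Fact μ.IsRegular]

variable (S μ) in
/-- The language with a binary relation symbol for each morphism of `S`. -/
abbrev morLanguage : Language μ where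
  Func := PEmpty
  Rel := Mor S
  funcArity := PEmpty.elim
  relArity _ := 2
  funcArity_lt F := F.elim
  relArity_lt _ := by
    rw [Cardinal.lt_ord]
    simpa using (Cardinal.natCast_lt_aleph0 (n := 2)).trans_le hμ.out.aleph0_le

theorem card_morLanguage : (morLanguage S μ).card = Cardinal.mk (Mor S) := by
  simp [Language.card]

variable {U V : Type w}

/-- An identification of the structure `M` with the structure of generalized elements of `X`. -/
structure Realization (M : Str (morLanguage S μ) U) (X : C) where
  equiv : M.carrier ≃ Elt G X
  rel_iff : ∀ (h : Mor S) (a b : M.carrier),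
    pair a b ∈ M.rel h ↔ Restricts h (equiv a) (equiv b)

variable {G}

theorem isSubmodel_of_pair {M N : Str (morLanguage S μ) U} (hs : M.carrier ⊆ N.carrier)
    (hr : ∀ (h : Mor S) (a b : M.carrier), pair a b ∈ M.rel h ↔
      pair (Set.inclusion hs a) (Set.inclusion hs b) ∈ N.rel h) : IsSubmodel M N where
  subset := hs
  map_fn F := F.elim
  map_rel h x := by
    obtain ⟨a, b, rfl⟩ := exists_eq_pair x
    rw [hr, comp_pair]

theorem IsSubmodel.rel_pair {M N : Str (morLanguage S μ) U} (hs : IsSubmodel M N)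
    (h : Mor S) (a b : M.carrier) : pair a b ∈ M.rel h ↔
      pair (Set.inclusion hs.subset a) (Set.inclusion hs.subset b) ∈ N.rel h := by
  rw [hs.map_rel, comp_pair]

theorem Emb.rel_pair {M : Str (morLanguage S μ) U} {N : Str (morLanguage S μ) V} (f : Emb M N)
    (h : Mor S) (a b : M.carrier) :
    pair a b ∈ M.rel h ↔ pair (f.toFun a) (f.toFun b) ∈ N.rel h := by
  rw [f.map_rel, comp_pair]

variable (G) in
/-- The structure on a set which is identified with the set of generalized elements of `X`. -/
def eltStr {X : C} (c : Set U) (φ : c ≃ Elt G X) : Str (morLanguage S μ) U where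
  carrier := c
  fn F := F.elim
  rel h := {x | ∃ a b, x = pair a b ∧ Restricts h (φ a) (φ b)}

/-- The tautological identification of `eltStr G c φ` with the generalized elements. -/
def realizationEltStr {X : C} (c : Set U) (φ : c ≃ Elt G X) :
    Realization G (eltStr (μ := μ) G c φ) X where
  equiv := φ
  rel_iff h a b := by
    constructor
    · rintro ⟨a', b', e, hr⟩
      obtain ⟨rfl, rfl⟩ := pair_inj e
      exact hr
    · exact fun hr => ⟨a, b, rfl, hr⟩

/-- Transport of a realization along an isomorphism. -/
noncomputable def Realization.ofIso {M : Str (morLanguage S μ) U} {N : Str (morLanguage S μ) V}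
    {X : C} (r : Realization G M X) (f : Emb M N) (hf : f.IsIso) : Realization G N X where
  equiv := (Equiv.ofBijective f.toFun ⟨f.inj, hf⟩).symm.trans r.equiv
  rel_iff _ a b := by
    obtain ⟨a, rfl⟩ := hf a
    obtain ⟨b, rfl⟩ := hf b
    rw [← f.rel_pair, r.rel_iff]
    simp only [Equiv.trans_apply]
    have key (x) : (Equiv.ofBijective f.toFun ⟨f.inj, hf⟩).symm (f.toFun x) = x :=
      Equiv.ofBijective_symm_apply_apply f.toFun ⟨f.inj, hf⟩ x
    rw [key, key]

theorem toImage_isIso {M : Str (morLanguage S μ) U} {N : Str (morLanguage S μ) V} (f : Emb M N) :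
    f.toImage.IsIso := f.equivRange.surjective

/-- The image of a realized structure is realized by the same object. -/
noncomputable def Realization.image {M : Str (morLanguage S μ) U} {N : Str (morLanguage S μ) V}
    {X : C} (r : Realization G M X) (f : Emb M N) : Realization G f.image X :=
  r.ofIso f.toImage (toImage_isIso f)

theorem exists_hom_of_emb [IsCardinalAccessibleCategory C μ] (hG : IsPresentableModel G μ)
    {M : Str (morLanguage S μ) U} {N : Str (morLanguage S μ) V}
    {X Y : C} (r : Realization G M X) (t : Realization G N Y) (e : Emb M N) :
    ∃ f : X ⟶ Y, ∀ x, t.equiv (e.toFun x) = Elt.map f (r.equiv x) := by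
  obtain ⟨f, hf⟩ := exists_hom_of_restricts hG
    (fun p : Elt G X => t.equiv (e.toFun (r.equiv.symm p))) (by
      intro h p q hpq
      rw [← t.rel_iff, ← e.rel_pair, r.rel_iff]
      simpa using hpq)
  exact ⟨f, fun x => by rw [← hf, Equiv.symm_apply_apply]⟩

/-- The embedding given by a monomorphism. -/
def embOfHom {M : Str (morLanguage S μ) U} {N : Str (morLanguage S μ) V}
    {X Y : C} (r : Realization G M X) (t : Realization G N Y) (f : X ⟶ Y) [Mono f] : Emb M N where
  toFun x := t.equiv.symm (Elt.map f (r.equiv x))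
  inj := t.equiv.symm.injective.comp ((Elt.map_injective f).comp r.equiv.injective)
  map_fn F := F.elim
  map_rel _ x := by
    obtain ⟨a, b, rfl⟩ := exists_eq_pair x
    rw [comp_pair, r.rel_iff, t.rel_iff]
    simp [restricts_map_iff]

theorem equiv_embOfHom {M : Str (morLanguage S μ) U} {N : Str (morLanguage S μ) V}
    {X Y : C} (r : Realization G M X) (t : Realization G N Y) (f : X ⟶ Y) [Mono f]
    (x : M.carrier) : t.equiv ((embOfHom r t f).toFun x) = Elt.map f (r.equiv x) := by
  simp [embOfHom]

variable (G μ) in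
/-- The class of the structures of generalized elements of the objects of `C`. -/
def eltClass : AbstractClass (morLanguage S μ) where
  mem M := ∃ X : C, Nonempty (Realization G M X)
  le M N := (∃ X : C, Nonempty (Realization G M X)) ∧ (∃ X : C, Nonempty (Realization G N X)) ∧
    IsSubmodel M N
  mem_left h := h.1
  mem_right h := h.2.1
  refl h := ⟨h, h, isSubmodel_of_pair subset_rfl fun _ _ _ => Iff.rfl⟩
  trans h h' := ⟨h.1, h'.2.1, isSubmodel_of_pair (h.2.2.subset.trans h'.2.2.subset)
    fun k a b => (h.2.2.rel_pair k a b).trans (h'.2.2.rel_pair k _ _)⟩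
  isSubmodel h := h.2.2
  mem_iso f hf := fun ⟨X, ⟨r⟩⟩ => ⟨X, ⟨r.ofIso f hf⟩⟩
  le_iso := fun f hf ⟨⟨X, ⟨r⟩⟩, ⟨Y, ⟨t⟩⟩, _⟩ =>
    ⟨⟨X, ⟨r.image _⟩⟩, ⟨Y, ⟨t.ofIso f hf⟩⟩, Emb.image_isSubmodel _⟩

theorem coherence_eltClass : (eltClass G μ).Coherence :=
  fun h₀ h₁ _ _ _ h => ⟨h₀, h₁, h⟩

/-- The image of a member is isomorphic to it, hence a member, and `≤` asks for nothing beyond `⊆`.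
-/
theorem isKEmb_eltClass {M : Str (morLanguage S μ) U} {N : Str (morLanguage S μ) V}
    (hM : (eltClass G μ).mem M) (hN : (eltClass G μ).mem N) (f : Emb M N) :
    (eltClass G μ).IsKEmb f :=
  ⟨hM.imp fun _ ⟨r⟩ => ⟨r.image f⟩, hN, f.image_isSubmodel⟩

end Structures

/-! ### Equivalence of `C` with the category of models. -/

section Equivalence

variable {C : Type u} [Category.{v} C] {S : Type w} [SmallCategory S] {G : S ⥤ C}
  {μ : Cardinal.{w}} [hμ : Fact μ.IsRegular] [IsCardinalAccessibleCategory C μ]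
  (hG : IsPresentableModel G μ) (hmono : ∀ {X Y : C} (f : X ⟶ Y), Mono f)

/-- The object realizing a model. -/
noncomputable def realizingObj (M : (eltClass G μ).Model) : C := M.mem.choose

/-- A realization of a model. -/
noncomputable def realization (M : (eltClass G μ).Model) :
    Realization G M.str (realizingObj M) := M.mem.choose_spec.some

/-- The morphism between realizing objects given by a morphism of models. -/
noncomputable def realizingHom {M N : (eltClass G μ).Model} (f : M ⟶ N) :
    realizingObj M ⟶ realizingObj N :=
  (exists_hom_of_emb hG (realization M) (realization N) f.1).choose

theorem map_realizingHom {M N : (eltClass G μ).Model} (f : M ⟶ N) (x : M.str.carrier) :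
    Elt.map (realizingHom hG f) ((realization M).equiv x) = (realization N).equiv (f.1.toFun x) :=
  ((exists_hom_of_emb hG (realization M) (realization N) f.1).choose_spec x).symm

/-- The functor sending a model to the object realizing it. -/
noncomputable def realizingFunctor : (eltClass G μ).Model ⥤ C where
  obj := realizingObj
  map f := realizingHom hG f
  map_id M := hom_ext_of_elt hG fun p => by
    obtain ⟨x, rfl⟩ := (realization M).equiv.surjective p
    rw [map_realizingHom, Elt.map_id]
    rfl
  map_comp {M N P} f g := hom_ext_of_elt hG fun p => by
    obtain ⟨x, rfl⟩ := (realization M).equiv.surjective p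
    rw [map_realizingHom, Elt.map_comp, map_realizingHom, map_realizingHom]
    rfl

instance : (realizingFunctor hG).Faithful where
  map_injective {M N f g} h := by
    refine Subtype.ext (Emb.ext (funext fun x => (realization N).equiv.injective ?_))
    rw [← map_realizingHom hG f, ← map_realizingHom hG g]
    exact congrArg (fun k => Elt.map k _) h

include hmono in
-- A monomorphism acts on elements as an embedding, and every embedding between models is a morphism
-- of models.
theorem full_realizingFunctor : (realizingFunctor hG).Full where
  map_surjective {M N} f := by
    have : Mono (X := realizingObj M) (Y := realizingObj N) f := hmono f
    refine ⟨⟨embOfHom (realization M) (realization N) f, isKEmb_eltClass M.mem N.mem _⟩,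
      hom_ext_of_elt hG fun p => ?_⟩
    obtain ⟨x, rfl⟩ := (realization M).equiv.surjective p
    exact (map_realizingHom hG _ x).trans (equiv_embOfHom _ _ f x)

/-- Local smallness makes `Elt G X` equivalent to a type in `Type w`, which can serve as the
universe. -/
theorem exists_realization (C : Type u) [Category.{v} C] [LocallySmall.{w} C] {G : S ⥤ C} (X : C) :
    ∃ (U : Type w) (M : Str (morLanguage S μ) U), Nonempty (Realization G M X) :=
  ⟨_, _, ⟨realizationEltStr Set.univ ((Equiv.Set.univ _).trans (equivShrink (Elt G X)).symm)⟩⟩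

/-- Objects with the same structure of generalized elements are isomorphic. -/
theorem nonempty_iso_of_realization {U : Type w} {M : Str (morLanguage S μ) U} {X Y : C}
    (hG : IsPresentableModel G μ) (r : Realization G M X) (t : Realization G M Y) :
    Nonempty (X ≅ Y) := by
  obtain ⟨f, hf⟩ := exists_hom_of_emb hG r t (Emb.id M)
  obtain ⟨g, hg⟩ := exists_hom_of_emb hG t r (Emb.id M)
  refine ⟨⟨f, g, hom_ext_of_elt hG fun p => ?_, hom_ext_of_elt hG fun p => ?_⟩⟩
  · obtain ⟨x, rfl⟩ := r.equiv.surjective p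
    rw [Elt.map_comp, ← hf, ← hg, Elt.map_id]
    rfl
  · obtain ⟨x, rfl⟩ := t.equiv.surjective p
    rw [Elt.map_comp, ← hg, ← hf, Elt.map_id]
    rfl

instance : (realizingFunctor hG).EssSurj where
  mem_essImage X := by
    obtain ⟨U, M, ⟨r⟩⟩ := exists_realization (μ := μ) C (G := G) X
    exact ⟨⟨M, X, ⟨r⟩⟩, nonempty_iso_of_realization hG (realization ⟨M, X, ⟨r⟩⟩) r⟩

include hG hmono in
theorem nonempty_equivalence : Nonempty (C ≌ (eltClass G μ).Model) := by
  have := full_realizingFunctor hG hmono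
  have : (realizingFunctor hG).IsEquivalence := { }
  exact ⟨(realizingFunctor hG).asEquivalence.symm⟩

end Equivalence

/-! ### Directed unions as colimits. -/

section Unions

variable {C : Type u} [Category.{v} C] {S : Type w} [SmallCategory S] {G : S ⥤ C}
  {μ : Cardinal.{w}} [hμ : Fact μ.IsRegular]

theorem IsDirectedSet.isCardinalFiltered {I : Type w} [PartialOrder I] (h : IsDirectedSet μ I) :
    IsCardinalFiltered I μ :=
  isCardinalFiltered_preorder _ _ fun _ s hK =>
    (h (Set.range s) (Cardinal.mk_range_le.trans_lt hK)).imp fun _ hj k => hj _ ⟨k, rfl⟩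

theorem exists_ge_ge_of_isFiltered {I : Type w} [PartialOrder I] [IsFiltered I] (i j : I) :
    ∃ k, i ≤ k ∧ j ≤ k :=
  ⟨IsFiltered.max i j, leOfHom (IsFiltered.leftToMax i j), leOfHom (IsFiltered.rightToMax i j)⟩

variable {U I : Type w} [PartialOrder I] {M : I → Str (morLanguage S μ) U}

/-- Each inclusion is induced by a morphism; functoriality follows because morphisms are determined
by their action on elements. -/
theorem exists_diagram_of_submodels [IsCardinalAccessibleCategory C μ]
    (hG : IsPresentableModel G μ) {X : I → C} (r : ∀ i, Realization G (M i) (X i))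
    (hM : ∀ i j, i ≤ j → IsSubmodel (M i) (M j)) :
    ∃ (F : I ⥤ C) (t : ∀ i, Realization G (M i) (F.obj i)),
      ∀ i j (h : i ⟶ j) x, (t j).equiv (Set.inclusion (hM i j (leOfHom h)).subset x) =
        Elt.map (F.map h) ((t i).equiv x) := by
  choose f hf using fun i j h => exists_hom_of_emb hG (r i) (r j) (hM i j h).incl
  refine ⟨{ obj := X, map := fun {i j} h => f i j (leOfHom h), map_id := fun i => ?_,
            map_comp := fun {i j k} a b => ?_ }, r, fun i j h x => hf i j (leOfHom h) x⟩
  · refine hom_ext_of_elt hG fun p => ?_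
    obtain ⟨x, rfl⟩ := (r i).equiv.surjective p
    rw [← hf, Elt.map_id]
    rfl
  · refine hom_ext_of_elt hG fun p => ?_
    obtain ⟨x, rfl⟩ := (r i).equiv.surjective p
    rw [← hf, Elt.map_comp, ← hf, ← hf]
    rfl

/-- The union of a `μ`-directed system of realized structures is identified with the generalized
elements of the colimit. -/
theorem exists_union_equiv [IsCardinalFiltered I μ] (hG : IsPresentableModel G μ)
    (hmono : ∀ {X Y : C} (f : X ⟶ Y), Mono f) {F : I ⥤ C} {c : Cocone F} (hc : IsColimit c)
    (t : ∀ i, Realization G (M i) (F.obj i)) (hM : ∀ i j, i ≤ j → IsSubmodel (M i) (M j))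
    (ht : ∀ i j (h : i ⟶ j) x, (t j).equiv (Set.inclusion (hM i j (leOfHom h)).subset x) =
        Elt.map (F.map h) ((t i).equiv x)) :
    ∃ φ : (⋃ i, (M i).carrier : Set U) ≃ Elt G c.pt, ∀ i (x : (M i).carrier),
      φ (Set.inclusion (Set.subset_iUnion (fun i => (M i).carrier) i) x) =
        Elt.map (c.ι.app i) ((t i).equiv x) := by
  have := isFiltered_of_isCardinalFiltered I μ
  have hstep {i k : I} (h : i ≤ k) {x : U} (hx : x ∈ (M i).carrier) (hx' : x ∈ (M k).carrier) :
      Elt.map (c.ι.app k) ((t k).equiv ⟨x, hx'⟩) = Elt.map (c.ι.app i) ((t i).equiv ⟨x, hx⟩) := by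
    have h1 := ht i k (homOfLE h) ⟨x, hx⟩
    change (t k).equiv ⟨x, hx'⟩ = _ at h1
    rw [h1, ← Elt.map_comp, c.w]
  -- The colimit element named by `x` does not depend on the stage containing `x`: compare at a
  -- common upper bound.
  have hind {i j : I} {x : U} (hx : x ∈ (M i).carrier) (hx' : x ∈ (M j).carrier) :
      Elt.map (c.ι.app i) ((t i).equiv ⟨x, hx⟩) = Elt.map (c.ι.app j) ((t j).equiv ⟨x, hx'⟩) := by
    obtain ⟨k, hik, hjk⟩ := exists_ge_ge_of_isFiltered i j
    have hxk := (hM i k hik).subset hx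
    rw [← hstep hik hx hxk, ← hstep hjk hx' hxk]
  choose i hi using fun x : (⋃ i, (M i).carrier : Set U) => Set.mem_iUnion.1 x.2
  let φ (x : (⋃ i, (M i).carrier : Set U)) : Elt G c.pt :=
    Elt.map (c.ι.app (i x)) ((t (i x)).equiv ⟨x, hi x⟩)
  have hφ (j : I) (x : (M j).carrier) :
      φ (Set.inclusion (Set.subset_iUnion (fun i => (M i).carrier) j) x) =
        Elt.map (c.ι.app j) ((t j).equiv x) := hind _ x.2
  have hinj : Function.Injective φ := by
    intro x y hxy
    obtain ⟨k, hik, hjk⟩ := exists_ge_ge_of_isFiltered (i x) (i y)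
    have hx := (hM _ k hik).subset (hi x)
    have hy := (hM _ k hjk).subset (hi y)
    have h1 : Elt.map (c.ι.app k) ((t k).equiv ⟨x, hx⟩) =
        Elt.map (c.ι.app k) ((t k).equiv ⟨y, hy⟩) :=
      (hstep hik (hi x) hx).trans (hxy.trans (hstep hjk (hi y) hy).symm)
    have := hmono (c.ι.app k)
    -- Injectivity is where the leg of the colimit must be monic.
    have h2 := (t k).equiv.injective (Elt.map_injective _ h1)
    have h3 := congrArg Subtype.val h2
    exact Subtype.ext h3
  have hsurj : Function.Surjective φ := by
    rintro ⟨s, g⟩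
    have := hG.presentable s
    -- Surjectivity is where presentability of `G.obj s` enters.
    obtain ⟨j, g', rfl⟩ := IsCardinalPresentable.exists_hom_of_isColimit μ hc g
    obtain ⟨x, hx⟩ := (t j).equiv.surjective ⟨s, g'⟩
    exact ⟨_, (hφ j x).trans (by rw [hx, Elt.map])⟩
  exact ⟨Equiv.ofBijective φ ⟨hinj, hsurj⟩, hφ⟩

theorem tarskiVaught_eltClass [IsCardinalAccessibleCategory C μ] (hG : IsPresentableModel G μ)
    (hmono : ∀ {X Y : C} (f : X ⟶ Y), Mono f) : (eltClass G μ).TarskiVaught := by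
  intro U I _ hI M hK hle
  have := hI.isCardinalFiltered
  have := isFiltered_of_isCardinalFiltered I μ
  have hM (i j : I) (h : i ≤ j) : IsSubmodel (M i) (M j) := by
    rcases h.eq_or_lt with rfl | h
    · exact (eltClass G μ).isSubmodel ((eltClass G μ).refl (hK i))
    · exact (eltClass G μ).isSubmodel (hle i j h)
  choose X r using hK
  obtain ⟨F, t, ht⟩ := exists_diagram_of_submodels hG (fun i => (r i).some) hM
  have : HasColimitsOfShape I C := HasCardinalFilteredColimits.hasColimitsOfShape (κ := μ) C I
  obtain ⟨φ, hφ⟩ := exists_union_equiv hG hmono (colimit.isColimit F) t hM ht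
  let P : Str (morLanguage S μ) U := eltStr G _ φ
  let ρ : Realization G P _ := realizationEltStr _ φ
  have hP : (eltClass G μ).mem P := ⟨_, ⟨ρ⟩⟩
  have hMP (i : I) : IsSubmodel (M i) P := by
    refine isSubmodel_of_pair (Set.subset_iUnion (fun i => (M i).carrier) i) fun h a b => ?_
    have := hmono ((colimit.cocone F).ι.app i)
    rw [(t i).rel_iff, ρ.rel_iff, ← restricts_map_iff ((colimit.cocone F).ι.app i), ← hφ, ← hφ]
    rfl
  refine ⟨P, ⟨rfl, hMP⟩, hP, fun j => ⟨⟨X j, r j⟩, hP, hMP j⟩, fun N hN hMN => ⟨hP, hN, ?_⟩⟩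
  -- The relations are binary, so each instance in the union can be checked inside a single `M k`, a
  -- submodel of both `P` and `N`.
  refine isSubmodel_of_pair (Set.iUnion_subset fun i => (hMN i).2.2.subset) fun h a b => ?_
  obtain ⟨i, hi⟩ := Set.mem_iUnion.1 a.2
  obtain ⟨j, hj⟩ := Set.mem_iUnion.1 b.2
  obtain ⟨k, hik, hjk⟩ := exists_ge_ge_of_isFiltered i j
  let a' : (M k).carrier := ⟨a, (hM _ _ hik).subset hi⟩
  let b' : (M k).carrier := ⟨b, (hM _ _ hjk).subset hj⟩
  exact ((hMP k).rel_pair h a' b').symm.trans ((hMN k).2.2.rel_pair h a' b')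

end Unions

/-! ### The Löwenheim–Skolem–Tarski number. -/

section LoewenheimSkolem

open Cardinal

variable {C : Type u} [Category.{v} C] {S : Type w} [SmallCategory S] {G : S ⥤ C}
  {μ : Cardinal.{w}} [hμ : Fact μ.IsRegular] [IsCardinalAccessibleCategory C μ]
  (hG : IsPresentableModel G μ) (hmono : ∀ {X Y : C} (f : X ⟶ Y), Mono f)

theorem mk_hom_to_le (t : S) : #(Σ s : S, (s ⟶ t)) ≤ #(Mor S) :=
  mk_le_of_injective (f := fun p : Σ s : S, (s ⟶ t) => (⟨p.1, t, p.2⟩ : Mor S)) (by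
    rintro ⟨s, f⟩ ⟨s', f'⟩ h
    obtain ⟨rfl, h⟩ := Sigma.mk.inj h
    obtain ⟨-, h⟩ := Sigma.mk.inj (eq_of_heq h)
    exact Sigma.ext rfl h)

include hG in
omit [IsCardinalAccessibleCategory C μ] in
/-- A structure realized by a `μ`-filtered colimit of `μ`-presentable objects is no larger than the
index set of the colimit, up to the number of morphisms between `μ`-presentable objects. -/
theorem mk_carrier_le {U B : Type w} [PartialOrder B] [IsCardinalFiltered B μ] {D : B ⥤ C}
    (hD : ∀ b, IsCardinalPresentable (D.obj b) μ) {c : Cocone D} (hc : IsColimit c)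
    {Q : Str (morLanguage S μ) U} (t : Realization G Q c.pt) :
    #Q.carrier ≤ #B * #(Mor S) := by
  choose s e using fun b => hG.exists_iso _ (hD b)
  -- By presentability and fullness, every element is a morphism of `S` into some `s b` followed by
  -- the leg at `b`, so these data enumerate the carrier.
  let f (p : Σ b : B, Σ x : S, (x ⟶ s b)) : Q.carrier :=
    t.equiv.symm ⟨p.2.1, G.map p.2.2 ≫ (e p.1).some.hom ≫ c.ι.app p.1⟩
  have hf : Function.Surjective f := by
    intro y
    obtain ⟨⟨x, g⟩, rfl⟩ := t.equiv.symm.surjective y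
    have := hG.presentable x
    obtain ⟨b, g', rfl⟩ := IsCardinalPresentable.exists_hom_of_isColimit μ hc g
    have := hG.full
    obtain ⟨k, hk⟩ := G.map_surjective (g' ≫ (e b).some.inv)
    refine ⟨⟨b, x, k⟩, ?_⟩
    simp only [f, hk]
    simp
  refine (mk_le_of_surjective hf).trans ?_
  rw [mk_sigma]
  refine (sum_le_sum _ (fun _ => #(Mor S)) fun b => mk_hom_to_le _).trans ?_
  rw [sum_const']

include hG hmono in
theorem exists_le_of_mk_le {κ : Cardinal.{w}} (hμκ : μ ≤ κ) (hκ : κ ^< μ = κ)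
    (hS : #(Mor S) ≤ κ) {U : Type w} (M : Str (morLanguage S μ) U) (hM : (eltClass G μ).mem M)
    (A : Set U) (hA : A ⊆ M.carrier) (hAκ : #A ≤ κ) :
    ∃ N, (eltClass G μ).le N M ∧ A ⊆ N.carrier ∧ #N.carrier ≤ κ := by
  obtain ⟨X, ⟨r⟩⟩ := id hM
  obtain ⟨J, _, _, ⟨p⟩⟩ := exists_directed_presentation C μ X
  -- Each point of `A` already lives at some stage `j a`; `B` will be a `μ`-directed set of at most
  -- `κ` stages containing all of these.
  have hfac (a : A) : ∃ (j : J) (g : G.obj (r.equiv ⟨a, hA a.2⟩).1 ⟶ p.diag.obj j),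
      g ≫ p.ι.app j = (r.equiv ⟨a, hA a.2⟩).2 := by
    have := hG.presentable (r.equiv ⟨a, hA a.2⟩).1
    exact IsCardinalPresentable.exists_hom_of_isColimit μ p.isColimit _
  choose j g hg using hfac
  obtain ⟨B, hAB, _, hB⟩ := exists_cardinalFiltered_set hμκ hκ (Set.range j)
    (mk_range_le.trans hAκ)
  have : HasColimitsOfShape B C := HasCardinalFilteredColimits.hasColimitsOfShape (κ := μ) C B
  let T : B ⥤ J := (Subtype.mono_coe (· ∈ B)).functor
  let m : colimit (T ⋙ p.diag) ⟶ X := colimit.desc (T ⋙ p.diag) (p.cocone.whisker T)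
  have hm (b : B) : colimit.ι (T ⋙ p.diag) b ≫ m = p.ι.app b :=
    colimit.ι_desc (p.cocone.whisker T) b
  -- The comparison from the subcolimit to `X` is monic, so its image is a submodel of `M`.
  have := hmono m
  obtain ⟨V, Q, ⟨t⟩⟩ := exists_realization (μ := μ) C (G := G) (colimit (T ⋙ p.diag))
  refine ⟨(embOfHom t r m).image, isKEmb_eltClass ⟨_, ⟨t⟩⟩ hM _, fun a ha => ?_, ?_⟩
  · let b : B := ⟨j ⟨a, ha⟩, hAB ⟨_, rfl⟩⟩
    refine ⟨t.equiv.symm ⟨_, g ⟨a, ha⟩ ≫ colimit.ι (T ⋙ p.diag) b⟩, ?_⟩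
    have h1 : Elt.map m ⟨_, g ⟨a, ha⟩ ≫ colimit.ι (T ⋙ p.diag) b⟩ = r.equiv ⟨a, hA ha⟩ := by
      refine Sigma.ext rfl (heq_of_eq ?_)
      exact (Category.assoc _ _ _).trans ((congrArg (g ⟨a, ha⟩ ≫ ·) (hm b)).trans (hg ⟨a, ha⟩))
    simp [embOfHom, h1]
  · refine mk_range_le.trans ((mk_carrier_le (D := T ⋙ p.diag) hG (fun b => p.prop_diag_obj b)
      (c := colimit.cocone _) (colimit.isColimit (T ⋙ p.diag)) t).trans ?_)
    exact (mul_le_mul' hB hS).trans (mul_eq_self (hμ.out.aleph0_le.trans hμκ)).le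

include hG hmono in
theorem lstProperty_eltClass :
    (eltClass G μ).LSTProperty ((max μ #(Mor S)) ^< μ) := by
  have h0 := hμ.out.aleph0_le
  have h1 : max μ #(Mor S) ≤ (max μ #(Mor S)) ^< μ := self_le_powerlt (one_lt_aleph0.trans_le h0)
  have h2 : ((max μ #(Mor S)) ^< μ) ^< μ = (max μ #(Mor S)) ^< μ :=
    powerlt_powerlt (((natCast_lt_aleph0 (n := 2)).le.trans h0).trans (le_max_left _ _))
  refine ⟨h2, ?_, fun M hM A hA => ?_⟩
  · rw [card_morLanguage]
    refine (add_le_add ((le_max_right _ _).trans h1) ((le_max_left _ _).trans h1)).trans ?_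
    exact (add_eq_self (h0.trans ((le_max_left _ _).trans h1))).le
  -- Here `κ` is `#A ^< μ + l` with `l` the claimed number; `powerlt_add_eq` gives `κ ^< μ = κ`.
  · refine exists_le_of_mk_le hG hmono (((le_max_left _ _).trans h1).trans le_add_self)
      (powerlt_add_eq ((le_max_left _ _).trans h1) h2)
      (((le_max_right _ _).trans h1).trans le_add_self) M hM A hA ?_
    exact (self_le_powerlt (one_lt_aleph0.trans_le h0)).trans le_self_add

include hG hmono in
-- For minimality, `l` bounds both `μ` and `#(Mor S)`, the size of the language, and applying `^< μ`
-- leaves `l` unchanged.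
theorem isLSTNumber_eltClass :
    (eltClass G μ).IsLSTNumber ((max μ #(Mor S)) ^< μ) := by
  refine ⟨lstProperty_eltClass hG hmono, fun l hl => ?_⟩
  have h := hl.2.1
  rw [card_morLanguage] at h
  rw [← hl.1]
  exact powerlt_mono_right (max_le (le_add_self.trans h) (le_self_add.trans h))

include hG hmono in
theorem isAEC_eltClass : (eltClass G μ).IsAEC where
  regular := hμ.out
  coherence := coherence_eltClass
  tarskiVaught := tarskiVaught_eltClass hG hmono
  lst := ⟨_, lstProperty_eltClass hG hmono⟩

end LoewenheimSkolem

/-- The inclusion of a small skeleton of the category of `μ`-presentable objects. -/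
noncomputable def presentableInclusion (C : Type u) [Category.{v} C] (μ : Cardinal.{w})
    [Fact μ.IsRegular] [IsCardinalAccessibleCategory C μ] :
    Skeleton (SmallModel.{w} (isCardinalPresentable C μ).FullSubcategory) ⥤ C :=
  (fromSkeleton _ ⋙ (equivSmallModel _).inverse) ⋙ (isCardinalPresentable C μ).ι

theorem isPresentableModel_presentableInclusion (C : Type u) [Category.{v} C] (μ : Cardinal.{w})
    [Fact μ.IsRegular] [IsCardinalAccessibleCategory C μ] :
    IsPresentableModel (presentableInclusion C μ) μ where
  full := by
    unfold presentableInclusion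
    infer_instance
  faithful := by
    unfold presentableInclusion
    infer_instance
  presentable s := ((fromSkeleton _ ⋙
    (equivSmallModel.{w} (isCardinalPresentable C μ).FullSubcategory).inverse).obj s).property
  exists_iso X hX := by
    let F := fromSkeleton _ ⋙
      (equivSmallModel.{w} (isCardinalPresentable C μ).FullSubcategory).inverse
    exact ⟨F.objPreimage ⟨X, hX⟩,
      ⟨(isCardinalPresentable C μ).ι.mapIso (F.objObjPreimageIso ⟨X, hX⟩)⟩⟩

end MuAEC

theorem theorem4p7 (C : Type u) [Category.{v} C] (μ : Cardinal.{w}) [Fact μ.IsRegular]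
    [IsCardinalAccessibleCategory C μ] (hmono : ∀ {X Y : C} (f : X ⟶ Y), Mono f) :
    ∃ (L : MuAEC.Language μ) (K : MuAEC.AbstractClass L),
      K.IsAEC ∧ Nonempty (C ≌ K.Model) ∧
        K.IsLSTNumber ((max μ (MuAEC.presentableMorphisms C μ)) ^< μ) := by
  have hG := MuAEC.isPresentableModel_presentableInclusion C μ
  -- For this skeleton, `#(Mor S)` is `presentableMorphisms C μ` by definition.
  exact ⟨_, MuAEC.eltClass (MuAEC.presentableInclusion C μ) μ, MuAEC.isAEC_eltClass hG hmono,
    MuAEC.nonempty_equivalence hG hmono, MuAEC.isLSTNumber_eltClass hG hmono⟩
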